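/- A checker path is a finite sequence of points of $\mathbb{Z}^2$ such that the vector from each point (except the last one) to the next one equals either $(1,1)$ or $(-1,1)$. For a checker path $s$, let $\mathrm{turns}(s)$ be the number of points in $s$ (not the first or the last one) such that the vectors from the point to the next and to the previous ones are orthogonal. For integers $x$ and $t > 0$ put $$a(x,t) := 2^{(1-t)/2}\, i \sum_s (-i)^{\mathrm{turns}(s)},$$ where the sum is over all checker paths $s$ from $(0,0)$ to $(x,t)$ containing $(1,1)$, and for integers $x$ and $t \ge 0$ put $$\tilde a_1(x,t) := \operatorname{Re} a(x,t+1).$$ **Theorem.** For each fixed integer $x \neq 0$, all sufficiently large integers $t$ with $t \not\equiv x \pmod 2$ satisfy $$\operatorname{sgn}(\tilde a_1(x,t)) = (-1)^{\lfloor t/4 \rfloor}.$$ Here $\operatorname{sgn}$ takes the values $-1, 0, 1$; in particular $\tilde a_1(x,t) \ne 0$ for these $t$. -/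

import Mathlib

namespace FeynmanCheckers

/-- One move of the checker on the lattice `ℤ × ℤ` (lattice step `ε = 1`): the vector from `p` to
`q` is `(1, 1)` or `(-1, 1)`. Points are written `(x, t)`. -/
def Step (p q : ℤ × ℤ) : Prop :=
  q - p = (1, 1) ∨ q - p = (-1, 1)

/-- A checker path: a finite sequence of lattice points in which consecutive points differ by a
move. -/
def IsCheckerPath (s : List (ℤ × ℤ)) : Prop :=
  s.IsChain Step

/-- The number of points of `s`, other than the first and the last one, such that the vectors from
the point to the next and to the previous points are orthogonal. -/
def turns : List (ℤ × ℤ) → ℕ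
  | p :: q :: r :: s =>
      (if (r.1 - q.1) * (p.1 - q.1) + (r.2 - q.2) * (p.2 - q.2) = 0 then 1 else 0)
        + turns (q :: r :: s)
  | _ => 0

/-- The checker paths from `(0, 0)` to `(x, t)` containing `(1, 1)`. -/
def paths (x t : ℤ) : Set (List (ℤ × ℤ)) :=
  {s | IsCheckerPath s ∧ s.head? = some (0, 0) ∧ s.getLast? = some (x, t) ∧ (1, 1) ∈ s}

theorem finite_of_length (n : ℕ) (p : ℤ × ℤ) :
    {s : List (ℤ × ℤ) | IsCheckerPath s ∧ s.head? = some p ∧ s.length = n + 1}.Finite := by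
  induction n generalizing p with
  | zero =>
    refine (Set.finite_singleton [p]).subset ?_
    rintro s ⟨-, h, hl⟩
    obtain ⟨a, rfl⟩ := List.length_eq_one_iff.1 (by simpa using hl)
    simpa using h
  | succ n ih =>
    refine (((ih (p + (1, 1))).union (ih (p + (-1, 1)))).image (List.cons p)).subset ?_
    rintro s ⟨hc, h, hl⟩
    match s, hc, h, hl with
    | a :: b :: s, hc, h, hl =>
      obtain rfl : a = p := by simpa using h
      obtain ⟨hab, hc'⟩ := List.isChain_cons_cons.1 hc
      refine ⟨b :: s, ?_, rfl⟩
      have hl' : (b :: s).length = n + 1 := by simpa using hl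
      rcases hab with hab | hab
      · exact Or.inl ⟨hc', by rw [← hab]; simp, hl'⟩
      · exact Or.inr ⟨hc', by rw [← hab]; simp, hl'⟩

theorem time_eq (s : List (ℤ × ℤ)) (p q : ℤ × ℤ) (hc : IsCheckerPath s)
    (hp : s.head? = some p) (hq : s.getLast? = some q) : p.2 + s.length = q.2 + 1 := by
  induction s generalizing p with
  | nil => simp at hp
  | cons a s ih =>
    obtain rfl : a = p := by simpa using hp
    cases s with
    | nil =>
      obtain rfl : a = q := by simpa using hq
      simp
    | cons b s =>
      obtain ⟨hab, hc'⟩ := List.isChain_cons_cons.1 hc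
      have h := ih b hc' rfl (by simpa using hq)
      have h2 : b.2 - a.2 = 1 := by
        rcases hab with hab | hab <;> simpa using congrArg Prod.snd hab
      simp only [List.length_cons, Nat.cast_add, Nat.cast_one] at h ⊢
      lia

/-- The sum in the definition of the wave function is a finite one. -/
theorem paths_finite (x t : ℤ) : (paths x t).Finite := by
  refine (finite_of_length t.toNat (0, 0)).subset ?_
  rintro s ⟨hc, hp, hq, -⟩
  refine ⟨hc, hp, ?_⟩
  have h := time_eq s _ _ hc hp hq
  have h0 : s.length ≠ 0 := by
    intro h0
    rw [List.length_eq_zero_iff] at h0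
    simp [h0] at hp
  simp only at h
  lia

/-- The wave function `a(x, t, m)` for lattice step `1` and particle mass `m`. It is meant for
`t > 0`. -/
noncomputable def a (x t : ℤ) (m : ℝ) : ℂ :=
  (((1 + m ^ 2) ^ ((1 - (t : ℝ)) / 2) : ℝ) : ℂ) * Complex.I *
    ∑ s ∈ (paths_finite x t).toFinset, (-Complex.I * (m : ℂ)) ^ turns s

/-- `ã₁(x, t)` for mass `1` and lattice step `1`. -/
noncomputable def aTilde₁ (x t : ℤ) : ℝ :=
  (a x (t + 1) 1).re

end FeynmanCheckers

/-! After the forced move to (1,1), the path sum obeys a two-component transfer recursion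
(`weight`). Eliminating the left-moving component leaves a second-order recurrence with real
coefficients; `amp` satisfies the same one, with boundary values opposite to those of the imaginary
part (`im_weight_true`). Since Re(iw) = -Im w, `aTilde₁ (r - l) (r + l + 1)` is a positive multiple
of `amp r l`.

Fixing x fixes a diagonal d = |x| of the symmetric array `amp`. Diagonal 0 consists of signed
central binomials and zeros; symmetry yields diagonal 1, and the recurrence all later ones. Relative
to `altCentral k`, expansions to order 1/k propagate, with closed forms depending on d mod 4
(`diagExpansion_four_mul`). The leading term vanishes only at odd positions for d = 4j and at even
positions for d = 4j + 2. There the 1/k coefficient, (-4)^j times 4j² or (2j + 1)², decides the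
sign; x ≠ 0 excludes j = 0 in the first case. -/

namespace FeynmanCheckers

/-! ### The array `amp`: recurrence, symmetry, first diagonals. -/

open Polynomial in
/-- The coefficient of `X ^ q` in `(1 - X) ^ p * (1 + X) ^ q`, that is
`∑ r, (-1) ^ r * p.choose r * q.choose r`. -/
noncomputable def amp (p q : ℕ) : ℝ :=
  (((1 - X) ^ p * (1 + X) ^ q : ℝ[X])).coeff q

open Polynomial in
theorem amp_zero_left (q : ℕ) : amp 0 q = 1 := by
  simp [amp, coeff_one_add_X_pow]

open Polynomial in
theorem amp_zero_right (p : ℕ) : amp p 0 = 1 := by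
  simp [amp, coeff_zero_eq_eval_zero]

open Polynomial in
theorem amp_succ_succ (p q : ℕ) :
    amp (p + 1) (q + 1) = amp (p + 1) q + amp p (q + 1) - 2 * amp p q := by
  unfold amp
  set F : ℝ[X] := (1 - X) ^ p * (1 + X) ^ q with hF
  -- Nesting `X * (X * F)` keeps `(X * F).coeff q` intact, so q = 0 needs no separate case.
  have h1 : ((1 - X) ^ (p + 1) * (1 + X) ^ (q + 1) : ℝ[X]) = F - X * (X * F) := by
    rw [hF]; ring
  have h2 : ((1 - X) ^ (p + 1) * (1 + X) ^ q : ℝ[X]) = F - X * F := by rw [hF]; ring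
  have h3 : ((1 - X) ^ p * (1 + X) ^ (q + 1) : ℝ[X]) = F + X * F := by rw [hF]; ring
  rw [h1, h2, h3]
  simp only [coeff_sub, coeff_add, coeff_X_mul]
  ring

theorem amp_comm (p q : ℕ) : amp p q = amp q p := by
  induction p generalizing q with
  | zero => rw [amp_zero_left, amp_zero_right]
  | succ p ihp =>
    induction q with
    | zero => rw [amp_zero_left, amp_zero_right]
    | succ q ihq =>
      rw [amp_succ_succ, amp_succ_succ, ihq, ihp (q + 1), ihp q]
      ring

open Polynomial in
theorem coeff_one_sub_X_pow (n k : ℕ) :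
    ((1 - X) ^ n : ℝ[X]).coeff k = (-1) ^ k * n.choose k := by
  have h : ((1 - X) ^ n : ℝ[X]) = ((1 + X) ^ n : ℝ[X]).comp (C (-1) * X) := by
    simp [sub_eq_add_neg]
  rw [h, comp_C_mul_X_coeff, coeff_one_add_X_pow]
  ring

open Polynomial in
theorem amp_self (q : ℕ) : amp q q = (expand ℝ 2 ((1 - X) ^ q)).coeff q := by
  rw [amp, ← mul_pow]
  simp only [map_pow, map_sub, map_one, expand_X]
  ring_nf

/-- The signed central binomial coefficient. -/
noncomputable def altCentral (k : ℕ) : ℝ := (-1) ^ k * k.centralBinom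

theorem altCentral_ne_zero (k : ℕ) : altCentral k ≠ 0 := by
  simp [altCentral, Nat.centralBinom_ne_zero]

theorem altCentral_succ (k : ℕ) :
    altCentral (k + 1) = -(4 - 2 / ((k : ℝ) + 1)) * altCentral k := by
  have h : ((k : ℝ) + 1) * (k + 1).centralBinom = 2 * (2 * k + 1) * k.centralBinom := by
    exact_mod_cast Nat.succ_mul_centralBinom_succ k
  have hk : (k : ℝ) + 1 ≠ 0 := by positivity
  have h' : ((k + 1).centralBinom : ℝ) = 2 * (2 * k + 1) * k.centralBinom / (k + 1) := by
    rw [← h]; field_simp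
  rw [altCentral, altCentral, h']
  field_simp
  ring

theorem amp_self_even (k : ℕ) : amp (2 * k) (2 * k) = altCentral k := by
  rw [amp_self, Polynomial.coeff_expand_mul' two_pos, coeff_one_sub_X_pow, altCentral,
    Nat.centralBinom]

theorem amp_self_odd (k : ℕ) : amp (2 * k + 1) (2 * k + 1) = 0 := by
  rw [amp_self, Polynomial.coeff_expand two_pos, if_neg (by omega)]

/-- By symmetry the two middle terms of the recurrence coincide, so diagonal 0 determines diagonal
1. -/
theorem amp_diag_one (q : ℕ) :
    amp (q + 1) q = amp (q + 1) (q + 1) / 2 + amp q q := by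
  have h := amp_succ_succ q q
  rw [amp_comm q (q + 1)] at h
  linarith

theorem amp_diag_add_two (d q : ℕ) :
    amp (q + (d + 2)) q
      = amp (q + 1 + (d + 1)) (q + 1) + 2 * amp (q + (d + 1)) q - amp (q + 1 + d) (q + 1) := by
  have h := amp_succ_succ (q + d + 1) q
  rw [show q + (d + 2) = q + d + 1 + 1 by ring, show q + 1 + (d + 1) = q + d + 1 + 1 by ring,
    show q + (d + 1) = q + d + 1 by ring, show q + 1 + d = q + d + 1 by ring]
  linarith

/-! ### Two-term expansions relative to central binomials. -/

open Filter Topology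

/-- `u k = altCentral k * (α + β / k + o(1 / k))`. -/
def HasExpansion (u : ℕ → ℝ) (α β : ℝ) : Prop :=
  Tendsto (fun k : ℕ => (k : ℝ) * (u k / altCentral k - α)) atTop (𝓝 β)

theorem hasExpansion_altCentral : HasExpansion altCentral 1 0 := by
  simp [HasExpansion, altCentral_ne_zero]

theorem hasExpansion_zero : HasExpansion (fun _ => 0) 0 0 := by
  simp [HasExpansion]

theorem HasExpansion.add {u v : ℕ → ℝ} {α β γ δ : ℝ} (hu : HasExpansion u α β)
    (hv : HasExpansion v γ δ) : HasExpansion (fun k => u k + v k) (α + γ) (β + δ) := by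
  refine (Tendsto.add hu hv).congr fun k => ?_
  rw [add_div]; ring

theorem HasExpansion.const_mul {u : ℕ → ℝ} {α β : ℝ} (c : ℝ) (hu : HasExpansion u α β) :
    HasExpansion (fun k => c * u k) (c * α) (c * β) := by
  refine (Tendsto.const_mul c hu).congr fun k => ?_
  rw [mul_div_assoc]; ring

theorem HasExpansion.tendsto {u : ℕ → ℝ} {α β : ℝ} (hu : HasExpansion u α β) :
    Tendsto (fun k => u k / altCentral k) atTop (𝓝 α) := by
  have h := (hu.mul tendsto_inv_atTop_nhds_zero_nat).add_const α
  rw [mul_zero, zero_add] at h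
  refine h.congr' ?_
  filter_upwards [eventually_gt_atTop 0] with k hk
  have : (k : ℝ) ≠ 0 := by positivity
  field_simp
  ring

/-- The ratio `altCentral (k + 1) / altCentral k` is -4 + 2/(k + 1); its correction term contributes
the 2α. -/
theorem HasExpansion.comp_succ {u : ℕ → ℝ} {α β : ℝ} (hu : HasExpansion u α β) :
    HasExpansion (fun k => u (k + 1)) (-4 * α) (2 * α - 4 * β) := by
  have h1 : Tendsto (fun k : ℕ => ((k + 1 : ℕ) : ℝ) * (u (k + 1) / altCentral (k + 1) - α))
      atTop (𝓝 β) := hu.comp (tendsto_add_atTop_nat 1)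
  have h2 : Tendsto (fun k : ℕ => u (k + 1) / altCentral (k + 1)) atTop (𝓝 α) :=
    hu.tendsto.comp (tendsto_add_atTop_nat 1)
  have h3 : Tendsto (fun k : ℕ => (k : ℝ) / (k + 1)) atTop (𝓝 1) :=
    tendsto_natCast_div_add_atTop 1
  have h := ((h2.mul h3).const_mul 2).sub ((h1.mul h3).const_mul 4)
  rw [mul_one, mul_one] at h
  refine h.congr fun k => ?_
  have hk : (k : ℝ) + 1 ≠ 0 := by positivity
  have e : u (k + 1) / altCentral k
      = -(4 - 2 / ((k : ℝ) + 1)) * (u (k + 1) / altCentral (k + 1)) := by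
    have hb := altCentral_ne_zero k
    have hb1 := altCentral_ne_zero (k + 1)
    rw [mul_div_assoc', div_eq_div_iff hb hb1, altCentral_succ]
    ring
  rw [e]
  push_cast
  field_simp
  ring

theorem HasExpansion.eventually_sign {u : ℕ → ℝ} {α β : ℝ} (hu : HasExpansion u α β) (ε : ℝ)
    (h : 0 < ε * α ∨ α = 0 ∧ 0 < ε * β) : ∀ᶠ k : ℕ in atTop, 0 < ε * (-1) ^ k * u k := by
  have key : ∀ᶠ k : ℕ in atTop, 0 < ε * (u k / altCentral k) := by
    rcases h with h | ⟨rfl, h⟩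
    · exact (hu.tendsto.const_mul ε).eventually (lt_mem_nhds h)
    · have h' := (Tendsto.const_mul ε hu).eventually (lt_mem_nhds h)
      filter_upwards [h'] with k hk
      rw [sub_zero, mul_left_comm] at hk
      exact pos_of_mul_pos_right hk k.cast_nonneg
  filter_upwards [key] with k hk
  have hc : (0 : ℝ) < k.centralBinom := by exact_mod_cast k.centralBinom_pos
  have := mul_pos hk hc
  have e : ε * (-1) ^ k * u k = ε * (u k / altCentral k) * k.centralBinom := by
    have h1 : ((-1 : ℝ) ^ k) * (-1) ^ k = 1 := by rw [← mul_pow]; simp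
    have h2 : ((-1 : ℝ) ^ k) ≠ 0 := by simp
    rw [altCentral]
    field_simp
    linear_combination ε * u k * h1
  rwa [e]

/-! ### Expansions and signs along diagonals. -/

/-- Expansions of the `d`-th diagonal of `amp` along even and odd positions. -/
def DiagExpansion (d : ℕ) (α β γ δ : ℝ) : Prop :=
  HasExpansion (fun k => amp (2 * k + d) (2 * k)) α β ∧
    HasExpansion (fun k => amp (2 * k + 1 + d) (2 * k + 1)) γ δ

theorem diagExpansion_zero : DiagExpansion 0 1 0 0 0 := by
  refine ⟨?_, ?_⟩
  · simpa only [add_zero, amp_self_even] using hasExpansion_altCentral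
  · simpa only [add_zero, amp_self_odd] using hasExpansion_zero

theorem diagExpansion_one : DiagExpansion 1 1 0 (-2) 1 := by
  refine ⟨?_, ?_⟩
  · simp only [amp_diag_one, amp_self_even, amp_self_odd]
    simpa using hasExpansion_altCentral
  · have h := hasExpansion_altCentral.comp_succ.const_mul (1 / 2)
    norm_num at h
    have e : ∀ k, amp (2 * k + 1 + 1) (2 * k + 1) = 1 / 2 * altCentral (k + 1) := by
      intro k
      rw [amp_diag_one, amp_self_odd, ← amp_self_even]
      ring_nf
    simpa only [e, one_div] using h

theorem DiagExpansion.add_two {d : ℕ} {α β γ δ α' β' γ' δ' : ℝ}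
    (h : DiagExpansion d α β γ δ) (h' : DiagExpansion (d + 1) α' β' γ' δ') :
    DiagExpansion (d + 2) (γ' + 2 * α' - γ) (δ' + 2 * β' - δ)
      (-4 * α' + 2 * γ' + 4 * α) (2 * α' - 4 * β' + 2 * δ' - 2 * α + 4 * β) := by
  refine ⟨?_, ?_⟩
  · convert (h'.2.add (h'.1.const_mul 2)).add (h.2.const_mul (-1)) using 1
    · funext k
      rw [amp_diag_add_two]
      ring
    · ring
    · ring
  -- The entry after position 2k + 1 is the even position 2(k + 1), hence the shifts.
  · convert (h'.1.comp_succ.add (h'.2.const_mul 2)).add (h.1.comp_succ.const_mul (-1)) using 1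
    · funext k
      rw [amp_diag_add_two, show 2 * (k + 1) = 2 * k + 1 + 1 by ring]
      ring
    · ring
    · ring

/-- The expansions along diagonals `4 * j` and `4 * j + 1`. -/
theorem diagExpansion_four_mul (j : ℕ) :
    DiagExpansion (4 * j) ((-4) ^ j) ((-4) ^ j * (-j / 2)) 0 ((-4) ^ j * (4 * j ^ 2)) ∧
    DiagExpansion (4 * j + 1) ((-4) ^ j) ((-4) ^ j * (2 * j ^ 2 + j / 2)) ((-4) ^ j * (-2))
      ((-4) ^ j * (4 * j ^ 2 + 3 * j + 1)) := by
  induction j with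
  | zero => simpa using ⟨diagExpansion_zero, diagExpansion_one⟩
  | succ j ih =>
    have h2 := ih.1.add_two ih.2
    have h3 := ih.2.add_two h2
    have h4 := h2.add_two h3
    have h5 := h3.add_two h4
    refine ⟨?_, ?_⟩
    · convert h4 using 1 <;> push_cast <;> ring
    · convert h5 using 1 <;> push_cast <;> ring

theorem diagExpansion_four_mul_add_two (j : ℕ) :
    DiagExpansion (4 * j + 2) 0 ((-4) ^ j * (2 * j + 1) ^ 2) ((-4) ^ j * (-4))
      ((-4) ^ j * (2 * j + 2)) := by
  convert (diagExpansion_four_mul j).1.add_two (diagExpansion_four_mul j).2 using 1 <;> ring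

theorem diagExpansion_four_mul_add_three (j : ℕ) :
    DiagExpansion (4 * j + 3) ((-4) ^ j * (-2)) ((-4) ^ j * (4 * j ^ 2 + 7 * j + 3))
      ((-4) ^ j * (-4)) ((-4) ^ j * (-8 * j ^ 2 - 10 * j - 2)) := by
  convert (diagExpansion_four_mul j).2.add_two (diagExpansion_four_mul_add_two j) using 1 <;> ring

theorem neg_one_pow_mul_neg_four_pow_pos (j : ℕ) : (0 : ℝ) < (-1) ^ j * (-4) ^ j := by
  rw [← mul_pow]; norm_num

/-- Signs on a nonzero diagonal of `amp`, far from the origin. -/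
theorem eventually_amp_diag_sign (d : ℕ) (hd : d ≠ 0) :
    ∀ᶠ q : ℕ in atTop, 0 < (-1) ^ ((2 * q + d + 1) / 4) * amp (q + d) q := by
  -- Here ε and ε' are the target signs at q = 0 and q = 1; raising q by 2 raises the exponent by 1.
  have combine : ∀ {ε ε' α β γ δ : ℝ}, DiagExpansion d α β γ δ →
      (0 < ε * α ∨ α = 0 ∧ 0 < ε * β) → (0 < ε' * γ ∨ γ = 0 ∧ 0 < ε' * δ) →
      (∀ k : ℕ, ε * (-1) ^ k = (-1) ^ ((2 * (2 * k) + d + 1) / 4)) →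
      (∀ k : ℕ, ε' * (-1) ^ k = (-1) ^ ((2 * (2 * k + 1) + d + 1) / 4)) →
      ∀ᶠ q : ℕ in atTop, 0 < (-1) ^ ((2 * q + d + 1) / 4) * amp (q + d) q := by
    intro ε ε' α β γ δ h h0 h1 e0 e1
    obtain ⟨n0, hn0⟩ := eventually_atTop.1 (h.1.eventually_sign ε h0)
    obtain ⟨n1, hn1⟩ := eventually_atTop.1 (h.2.eventually_sign ε' h1)
    filter_upwards [eventually_ge_atTop (2 * (n0 + n1) + 1)] with q hq
    obtain ⟨k, rfl | rfl⟩ := Nat.even_or_odd' q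
    · rw [← e0]; exact hn0 k (by omega)
    · rw [← e1]; exact hn1 k (by omega)
  obtain ⟨j, hj⟩ : ∃ j, d = 4 * j ∨ d = 4 * j + 1 ∨ d = 4 * j + 2 ∨ d = 4 * j + 3 :=
    ⟨d / 4, by omega⟩
  have hp := neg_one_pow_mul_neg_four_pow_pos j
  rcases hj with rfl | rfl | rfl | rfl
  · refine combine (ε := (-1) ^ j) (ε' := (-1) ^ j) (diagExpansion_four_mul j).1 (Or.inl hp)
      (Or.inr ⟨rfl, ?_⟩) (fun k => ?_) (fun k => ?_)
    -- The coefficient 4j² is positive only because d ≠ 0; on diagonal 0 these entries vanish.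
    · have : (j : ℝ) ≠ 0 := by exact_mod_cast fun h => hd (by simp [h])
      rw [← mul_assoc]; positivity
    · rw [← pow_add]; congr 1; omega
    · rw [← pow_add]; congr 1; omega
  · refine combine (ε := (-1) ^ j) (ε' := (-1) ^ (j + 1)) (diagExpansion_four_mul j).2 (Or.inl hp)
      (Or.inl ?_) (fun k => ?_) (fun k => ?_)
    · rw [pow_succ]; linarith
    · rw [← pow_add]; congr 1; omega
    · rw [← pow_add]; congr 1; omega
  · refine combine (ε := (-1) ^ j) (ε' := (-1) ^ (j + 1)) (diagExpansion_four_mul_add_two j)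
      (Or.inr ⟨rfl, ?_⟩) (Or.inl ?_) (fun k => ?_) (fun k => ?_)
    · rw [← mul_assoc]; positivity
    · rw [pow_succ]; linarith
    · rw [← pow_add]; congr 1; omega
    · rw [← pow_add]; congr 1; omega
  · refine combine (ε := (-1) ^ (j + 1)) (ε' := (-1) ^ (j + 1)) (diagExpansion_four_mul_add_three j)
      (Or.inl ?_) (Or.inl ?_) (fun k => ?_) (fun k => ?_)
    · rw [pow_succ]; linarith
    · rw [pow_succ]; linarith
    · rw [← pow_add]; congr 1; omega
    · rw [← pow_add]; congr 1; omega

/-! ### The transfer recursion and its identification with `amp`. -/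

/-- The total weight of the checker paths making `n` moves with displacement `y`, where the move
preceding the path goes to the right if `b` is `true` and to the left otherwise. -/
noncomputable def weight : Bool → ℕ → ℤ → ℂ
  | _, 0, y => if y = 0 then 1 else 0
  | true, n + 1, y => weight true n (y - 1) + -Complex.I * weight false n (y + 1)
  | false, n + 1, y => -Complex.I * weight true n (y - 1) + weight false n (y + 1)

theorem weight_eq_zero (b : Bool) (n : ℕ) (y : ℤ) (h : (n : ℤ) < |y|) : weight b n y = 0 := by
  induction n generalizing b y with
  | zero =>
    have : y ≠ 0 := by rintro rfl; simp at h
    cases b <;> simp [weight, this]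
  | succ n ih =>
    push_cast at h
    have h1 := ih true (y - 1) (by rw [lt_abs] at *; omega)
    have h2 := ih false (y + 1) (by rw [lt_abs] at *; omega)
    cases b <;> simp [weight, h1, h2]

theorem weight_true_self (n : ℕ) : weight true n n = 1 := by
  induction n with
  | zero => simp [weight]
  | succ n ih =>
    have h := weight_eq_zero false n (n + 1 + 1) (by rw [lt_abs]; omega)
    simp [weight, ih, h]

theorem weight_false_neg_self (n : ℕ) : weight false n (-n) = 1 := by
  induction n with
  | zero => simp [weight]
  | succ n ih =>
    have h := weight_eq_zero true n (-(n + 1) - 1) (by rw [lt_abs]; omega)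
    have e : (-((n + 1 : ℕ) : ℤ)) = -(n + 1) := by push_cast; ring
    rw [e, weight, h, show (-((n : ℤ) + 1) + 1) = -n by ring, ih]
    simp

theorem re_weight_false_succ_self (n : ℕ) :
    (weight false (n + 1) (n + 1 : ℕ)).re = 0 := by
  have h := weight_eq_zero false n (n + 1 + 1) (by rw [lt_abs]; omega)
  simp [weight, h, weight_true_self]

theorem weight_true_add_two (n : ℕ) (y : ℤ) :
    weight true (n + 2) y
      = weight true (n + 1) (y - 1) + weight true (n + 1) (y + 1) - 2 * weight true n y := by
  have h1 : weight true (n + 2) y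
      = weight true (n + 1) (y - 1) + -Complex.I * weight false (n + 1) (y + 1) := by
    rw [weight]
  have h2 : weight false (n + 1) (y + 1)
      = -Complex.I * weight true n y + weight false n (y + 1 + 1) := by
    rw [weight, add_sub_cancel_right]
  have h3 : weight true (n + 1) (y + 1)
      = weight true n y + -Complex.I * weight false n (y + 1 + 1) := by
    rw [weight, add_sub_cancel_right]
  rw [h1, h2, h3]
  linear_combination weight true n y * Complex.I_sq

/-- These paths make r right and l + 1 left moves. For l = 0, starting with the left move and then
going right gives a real weight, so it does not contribute. -/
theorem im_weight_true (r l : ℕ) :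
    (weight true (r + l + 1) (r - l - 1)).im = -amp r l := by
  induction r generalizing l with
  | zero =>
    have h := weight_eq_zero true l (-(l : ℤ) - 1 - 1) (by rw [lt_abs]; omega)
    have e : -(l : ℤ) - 1 + 1 = -l := by ring
    simp [weight, h, e, weight_false_neg_self, amp_zero_left]
  | succ r ihr =>
    induction l with
    | zero =>
      have h0 := ihr 0
      rw [amp_zero_right] at h0
      have e : ((r + 1 : ℕ) : ℤ) - (0 : ℕ) - 1 = (r : ℤ) := by push_cast; ring
      rw [e, amp_zero_right, weight]
      have h2 := re_weight_false_succ_self r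
      push_cast at h0 h2
      rw [sub_zero] at h0
      simp only [add_zero] at h0 ⊢
      simp [h0, h2]
    | succ l ihl =>
      have h := weight_true_add_two (r + l + 1) (r - l - 1)
      have e1 : ((r + 1 : ℕ) : ℤ) - (l + 1 : ℕ) - 1 = r - l - 1 := by push_cast; ring
      have e2 : ((r + 1 : ℕ) : ℤ) - l - 1 = r - l - 1 + 1 := by push_cast; ring
      have h1 := ihr (l + 1)
      have e3 : (r : ℤ) - (l + 1 : ℕ) - 1 = r - l - 1 - 1 := by push_cast; ring
      have h3 := ihr l
      rw [e2, show r + 1 + l + 1 = r + l + 1 + 1 by ring] at ihl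
      rw [e3, show r + (l + 1) + 1 = r + l + 1 + 1 by ring] at h1
      rw [e1, show r + 1 + (l + 1) + 1 = r + l + 1 + 2 by ring, h, amp_succ_succ]
      simp only [Complex.sub_im, Complex.add_im, Complex.mul_im, ihl, h1, h3, Complex.re_ofNat,
        Complex.im_ofNat]
      ring

/-! ### From sets of paths to the recursion. -/

/-- The checker paths from `p` to `e` making `n` moves. -/
def walks (e : ℤ × ℤ) : ℕ → ℤ × ℤ → Finset (List (ℤ × ℤ))
  | 0, p => if p = e then {[p]} else ∅
  | n + 1, p => (walks e n (p + (1, 1))).image (List.cons p) ∪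
      (walks e n (p + (-1, 1))).image (List.cons p)

theorem mem_walks (e : ℤ × ℤ) (n : ℕ) (p : ℤ × ℤ) (s : List (ℤ × ℤ)) :
    s ∈ walks e n p ↔
      IsCheckerPath s ∧ s.head? = some p ∧ s.getLast? = some e ∧ s.length = n + 1 := by
  induction n generalizing p s with
  | zero =>
    constructor
    · intro h
      rw [walks] at h
      split_ifs at h with hp
      · obtain rfl := Finset.mem_singleton.1 h
        simp [IsCheckerPath, hp]
      · simp at h
    · rintro ⟨-, h1, h2, h3⟩
      obtain ⟨a, rfl⟩ := List.length_eq_one_iff.1 (by simpa using h3)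
      obtain rfl : a = p := by simpa using h1
      obtain rfl : a = e := by simpa using h2
      simp [walks]
  | succ n ih =>
    simp only [walks, Finset.mem_union, Finset.mem_image, ih]
    constructor
    · rintro (⟨s, ⟨hc, h1, h2, h3⟩, rfl⟩ | ⟨s, ⟨hc, h1, h2, h3⟩, rfl⟩) <;>
      · match s, h1 with
        | b :: s, h1 =>
          obtain rfl := Option.some.inj h1
          refine ⟨List.isChain_cons_cons.2 ⟨?_, hc⟩, rfl, by simpa using h2, by simpa using h3⟩
          simp [Step]
    · rintro ⟨hc, h1, h2, h3⟩
      match s, hc, h1, h2, h3 with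
      | a :: b :: s, hc, h1, h2, h3 =>
        obtain rfl : a = p := by simpa using h1
        obtain ⟨hab, hc'⟩ := List.isChain_cons_cons.1 hc
        have h2' : (b :: s).getLast? = some e := by simpa using h2
        have h3' : (b :: s).length = n + 1 := by simpa using h3
        rcases hab with hab | hab
        · exact Or.inl ⟨b :: s, ⟨hc', by rw [← hab]; simp, h2', h3'⟩, rfl⟩
        · exact Or.inr ⟨b :: s, ⟨hc', by rw [← hab]; simp, h2', h3'⟩, rfl⟩

theorem disjoint_walks_of_ne (e : ℤ × ℤ) (n : ℕ) {p q : ℤ × ℤ} (h : p ≠ q) :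
    Disjoint (walks e n p) (walks e n q) := by
  refine Finset.disjoint_left.2 fun s hp hq => h ?_
  have h1 := ((mem_walks e n p s).1 hp).2.1
  have h2 := ((mem_walks e n q s).1 hq).2.1
  exact Option.some.inj (h1.symm.trans h2)

theorem sum_walks_succ (e : ℤ × ℤ) (n : ℕ) (p : ℤ × ℤ) (f : List (ℤ × ℤ) → ℂ) :
    ∑ s ∈ walks e (n + 1) p, f s
      = ∑ s ∈ walks e n (p + (1, 1)), f (p :: s) + ∑ s ∈ walks e n (p + (-1, 1)), f (p :: s) := by
  have hd : Disjoint (walks e n (p + (1, 1))) (walks e n (p + (-1, 1))) :=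
    disjoint_walks_of_ne e n (by simp)
  rw [walks, ← Finset.image_union, Finset.sum_image (List.cons_injective.injOn),
    Finset.sum_union hd]

/-- The move to the right (`true`) or to the left (`false`). -/
def move : Bool → ℤ × ℤ
  | true => (1, 1)
  | false => (-1, 1)

theorem turns_cons_cons_of_mem_walks {e : ℤ × ℤ} {n : ℕ} {p : ℤ × ℤ} {s : List (ℤ × ℤ)}
    (b c : Bool) (hs : s ∈ walks e n (p + move c)) :
    turns ((p - move b) :: p :: s) = (if b = c then 0 else 1) + turns (p :: s) := by
  obtain ⟨-, h, -, -⟩ := (mem_walks _ _ _ _).1 hs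
  match s, h with
  | a :: s, h =>
    obtain rfl := Option.some.inj h
    rw [turns]
    cases b <;> cases c <;> simp [move]

/-- The prepended point `p - move b` makes a turn at p visible to `turns`; for p = (1,1) and b =
`true` it is the origin. -/
theorem sum_walks_eq_weight (e : ℤ × ℤ) (n : ℕ) (p : ℤ × ℤ) (b : Bool) (h : e.2 = p.2 + n) :
    ∑ s ∈ walks e n p, (-Complex.I) ^ turns ((p - move b) :: s) = weight b n (e.1 - p.1) := by
  induction n generalizing p b with
  | zero =>
    have hw : weight b 0 (e.1 - p.1) = if e.1 - p.1 = 0 then 1 else 0 := by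
      cases b <;> simp [weight]
    have hpe : p = e ↔ e.1 - p.1 = 0 := by
      rw [Prod.ext_iff, sub_eq_zero]
      constructor
      · exact fun h => h.1.symm
      · exact fun h' => ⟨h'.symm, by simpa using h.symm⟩
    rw [hw, walks]
    by_cases hp : e.1 - p.1 = 0
    · rw [if_pos (hpe.2 hp), if_pos hp]
      simp [turns]
    · rw [if_neg (mt hpe.1 hp), if_neg hp]
      simp
  | succ n ih =>
    have key : ∀ c : Bool, ∑ s ∈ walks e n (p + move c),
        (-Complex.I) ^ turns ((p - move b) :: p :: s)
          = (-Complex.I) ^ (if b = c then 0 else 1) * weight c n (e.1 - (p + move c).1) := by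
      intro c
      rw [← ih (p + move c) c (by cases c <;> simp [move] <;> push_cast at h <;> omega),
        Finset.mul_sum]
      refine Finset.sum_congr rfl fun s hs => ?_
      rw [turns_cons_cons_of_mem_walks b c hs, pow_add, add_sub_cancel_right]
    have k1 := key true
    have k2 := key false
    rw [sum_walks_succ]
    change ∑ s ∈ walks e n (p + move true), _ + ∑ s ∈ walks e n (p + move false), _ = _
    rw [k1, k2, show e.1 - (p + move true).1 = e.1 - p.1 - 1 by simp [move]; ring,
      show e.1 - (p + move false).1 = e.1 - p.1 + 1 by simp [move]; ring]
    cases b <;> simp [weight]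

theorem IsCheckerPath.le_snd {p : ℤ × ℤ} {s : List (ℤ × ℤ)} (hc : IsCheckerPath (p :: s))
    {q : ℤ × ℤ} (hq : q ∈ s) : p.2 + 1 ≤ q.2 := by
  induction s generalizing p with
  | nil => simp at hq
  | cons b s ih =>
    obtain ⟨hab, hc'⟩ := List.isChain_cons_cons.1 hc
    have hb : b.2 - p.2 = 1 := by
      rcases hab with hab | hab <;> simpa using congrArg Prod.snd hab
    rcases List.mem_cons.1 hq with rfl | hq
    · omega
    · have := ih hc' hq
      omega

/-- Time grows by 1 at each move, so (1,1) can only be the second point. -/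
theorem mem_paths_iff (x : ℤ) (n : ℕ) (s : List (ℤ × ℤ)) :
    s ∈ paths x (n + 1) ↔ ∃ u ∈ walks (x, (n : ℤ) + 1) n (1, 1), (0, 0) :: u = s := by
  constructor
  · rintro ⟨hc, h1, h2, h3⟩
    have hl := time_eq s _ _ hc h1 h2
    match s, hc, h1, h2, h3, hl with
    | [c], hc, h1, h2, h3, hl =>
      obtain rfl : c = (0, 0) := by simpa using h1
      simp at h3
    | c :: b :: s, hc, h1, h2, h3, hl =>
      obtain rfl : c = (0, 0) := by simpa using h1
      obtain ⟨hab, hc'⟩ := List.isChain_cons_cons.1 hc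
      have hb : b.2 = 1 := by
        rcases hab with hab | hab <;> simpa using congrArg Prod.snd hab
      obtain rfl : b = (1, 1) := by
        rcases List.mem_cons.1 h3 with h3 | h3
        · simp at h3
        · rcases List.mem_cons.1 h3 with h3 | h3
          · exact h3.symm
          · have := IsCheckerPath.le_snd hc' h3
            simp only at this
            omega
      refine ⟨_, (mem_walks _ _ _ _).2 ⟨hc', rfl, by simpa using h2, ?_⟩, rfl⟩
      simp only [List.length_cons] at hl ⊢
      push_cast at hl
      omega
  · rintro ⟨u, hu, rfl⟩
    obtain ⟨hc, h1, h2, h3⟩ := (mem_walks _ _ _ _).1 hu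
    match u, h1 with
    | b :: u, h1 =>
      obtain rfl := Option.some.inj h1
      exact ⟨List.isChain_cons_cons.2 ⟨by simp [Step], hc⟩, rfl, by simpa using h2, by simp⟩

theorem sum_paths_eq_weight (x : ℤ) (n : ℕ) :
    ∑ s ∈ (paths_finite x (n + 1)).toFinset, (-Complex.I) ^ turns s = weight true n (x - 1) := by
  have h : (paths_finite x (n + 1)).toFinset
      = (walks (x, (n : ℤ) + 1) n (1, 1)).image (List.cons (0, 0)) := by
    ext s
    rw [Set.Finite.mem_toFinset, mem_paths_iff, Finset.mem_image]
  rw [h, Finset.sum_image List.cons_injective.injOn]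
  exact sum_walks_eq_weight (x, (n : ℤ) + 1) n (1, 1) true (by simp; ring)

/-! ### Signs of the wave function. -/

/-- The real part of the wave function is a positive multiple of `amp`. -/
theorem aTilde₁_eq (r l : ℕ) :
    aTilde₁ (r - l) (r + l + 1) = 2 ^ (-((r : ℝ) + l + 1) / 2) * amp r l := by
  have h := sum_paths_eq_weight (r - l) (r + l + 1)
  push_cast at h
  rw [aTilde₁, a]
  simp only [Complex.ofReal_one, mul_one]
  rw [h, mul_assoc, Complex.re_ofReal_mul, Complex.I_mul_re, im_weight_true, neg_neg]
  congr 2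
  · norm_num
  · push_cast; ring

theorem floor_intCast_div_four (t : ℕ) : ⌊((t : ℤ) : ℝ) / 4⌋ = ((t / 4 : ℕ) : ℤ) := by
  have h1 : (4 * (t / 4 : ℕ) : ℝ) ≤ t := by exact_mod_cast Nat.mul_div_le t 4
  have h2 : (t : ℝ) < 4 * (t / 4 : ℕ) + 4 := by
    exact_mod_cast show t < 4 * (t / 4) + 4 by omega
  rw [Int.floor_eq_iff, Int.cast_natCast, Int.cast_natCast]
  constructor <;> linarith

theorem sign_aTilde₁_of_amp_sign {r l : ℕ} (h : 0 < (-1 : ℝ) ^ ((r + l + 1) / 4) * amp r l) :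
    Real.sign (aTilde₁ (r - l) (r + l + 1))
      = (-1 : ℝ) ^ ⌊(((r + l + 1 : ℕ) : ℤ) : ℝ) / 4⌋ := by
  rw [aTilde₁_eq, floor_intCast_div_four, zpow_natCast]
  have hc : (0 : ℝ) < 2 ^ (-((r : ℝ) + l + 1) / 2) := by positivity
  rcases neg_one_pow_eq_or ℝ ((r + l + 1) / 4) with e | e
  · rw [e] at h ⊢
    exact Real.sign_of_pos (mul_pos hc (by linarith))
  · rw [e] at h ⊢
    exact Real.sign_of_neg (mul_neg_of_pos_of_neg hc (by linarith))

end FeynmanCheckers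

theorem theorem4 (x : ℤ) (hx : x ≠ 0) :
    ∃ t₀ : ℤ, ∀ t : ℤ, t₀ ≤ t → ¬ t ≡ x [ZMOD 2] →
      Real.sign (FeynmanCheckers.aTilde₁ x t) = (-1 : ℝ) ^ ⌊(t : ℝ) / 4⌋ := by
  obtain ⟨q₀, hq₀⟩ := Filter.eventually_atTop.1
    (FeynmanCheckers.eventually_amp_diag_sign x.natAbs (by simpa using hx))
  refine ⟨2 * q₀ + x.natAbs + 1, fun t ht hpar => ?_⟩
  obtain ⟨q, hq⟩ : ∃ q : ℕ, t = 2 * q + x.natAbs + 1 := by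
    refine ⟨((t - x.natAbs - 1) / 2).toNat, ?_⟩
    rw [Int.ModEq] at hpar
    omega
  have hpos := hq₀ q (by omega)
  obtain ⟨r, l, hr, ht', hpos'⟩ : ∃ r l : ℕ, x = r - l ∧ t = ((r + l + 1 : ℕ) : ℤ) ∧
      0 < (-1 : ℝ) ^ ((r + l + 1) / 4) * FeynmanCheckers.amp r l := by
    rw [show 2 * q + x.natAbs + 1 = q + x.natAbs + q + 1 by ring] at hpos
    -- Negative x is reflected to the diagonal |x| by the symmetry of `amp`.
    rcases le_total 0 x with h | h
    · exact ⟨q + x.natAbs, q, by omega, by omega, hpos⟩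
    · refine ⟨q, q + x.natAbs, by omega, by omega, ?_⟩
      rwa [FeynmanCheckers.amp_comm, add_comm q (q + x.natAbs)]
  subst hr ht'
  rw [← FeynmanCheckers.sign_aTilde₁_of_amp_sign hpos']
  push_cast
  rfl
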